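/- Let $\varrho$ be the substitution $0\mapsto 02$, $1\mapsto 32$, $2\mapsto 01$, $3\mapsto 31$ on the alphabet $\{0,1,2,3\}$. Let $u=(u_i)_{i\in\mathbb{Z}}$ be any of the bi-infinite fixed points of $\varrho^2$ with seed $u_{-1}|u_0\in\{2|0,\,2|3,\,1|0,\,1|3\}$, and let $w=(w_i)_{i\in\mathbb{Z}}$ be the corresponding balanced Rudin--Shapiro sequence, that is, $w_i=1$ if $u_i\in\{0,2\}$ and $w_i=-1$ if $u_i\in\{1,3\}$. Then, for all $(m_1,m_2,m_3)\in\mathbb{Z}^3$, the limits \[ \eta^{(4)}(m_1,m_2,m_3)=\lim_{N\to\infty}\frac{1}{2N+1}\sum_{i=-N}^{N} w_i\,w_{i+m_1}w_{i+m_2}w_{i+m_3}, \] \[ \theta^{(4)}(m_1,m_2,m_3)=\lim_{N\to\infty}\frac{1}{2N+1}\sum_{i=-N}^{N}(-1)^i\, w_i\,w_{i+m_1}w_{i+m_2}w_{i+m_3} \] exist. Moreover, for all $(m_1,m_2,m_3)\in\mathbb{Z}^3$, one has $\eta^{(4)}(m_1,m_2,m_3)=1$ if and only if there is a permutation $\sigma$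 of $\{1,2,3\}$ with $m_{\sigma(1)}=0$ and $m_{\sigma(2)}=m_{\sigma(3)}$, and one has $|\theta^{(4)}(m_1,m_2,m_3)|<1$. -/

import Mathlib

open Filter Topology

namespace RudinShapiro

/-- The quaternary Rudin–Shapiro substitution `0 ↦ 02`, `1 ↦ 32`, `2 ↦ 01`, `3 ↦ 31`;
`subst x k` is the `k`-th letter of the image of `x`. -/
def subst : Fin 4 → Fin 2 → Fin 4 :=
  ![![0, 2], ![3, 2], ![0, 1], ![3, 1]]

/-- The substitution acting on bi-infinite words: the image of the letter at position `j`
occupies the positions `2 * j` and `2 * j + 1` (`i / 2` is the floor). -/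
def inflate (u : ℤ → Fin 4) (i : ℤ) : Fin 4 :=
  subst (u (i / 2)) (if Even i then 0 else 1)

/-- The quaternary Rudin–Shapiro sequences: the bi-infinite fixed points of the square of the
substitution with one of the legal seeds `2|0`, `2|3`, `1|0`, `1|3`, where the seed `x|y`
consists of the letters at positions `-1` and `0`. -/
def IsQuaternary (u : ℤ → Fin 4) : Prop :=
  Function.IsFixedPt (inflate ∘ inflate) u ∧
    (u (-1), u 0) ∈ ({(2, 0), (2, 3), (1, 0), (1, 3)} : Set (Fin 4 × Fin 4))

/-- The reduction to two letters `0, 2 ↦ a`, `1, 3 ↦ b`, with balanced weights `a = 1`,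
`b = -1`. -/
def weight : Fin 4 → ℝ :=
  ![1, -1, 1, -1]

/-- The balanced (bi-infinite, binary) Rudin–Shapiro sequences. -/
def IsBalanced (w : ℤ → ℝ) : Prop :=
  ∃ u : ℤ → Fin 4, IsQuaternary u ∧ w = weight ∘ u

/-- The averages whose limit is the `(k + 1)`-point correlation at `m = (m₁, …, m_k)`. -/
noncomputable def etaAvg (w : ℤ → ℝ) {k : ℕ} (m : Fin k → ℤ) (N : ℕ) : ℝ :=
  1 / (2 * (N : ℝ) + 1) *
    ∑ i ∈ Finset.Icc (-(N : ℤ)) (N : ℤ), w i * ∏ j, w (i + m j)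

/-- The averages whose limit is the signed `(k + 1)`-point correlation at `m = (m₁, …, m_k)`. -/
noncomputable def thetaAvg (w : ℤ → ℝ) {k : ℕ} (m : Fin k → ℤ) (N : ℕ) : ℝ :=
  1 / (2 * (N : ℝ) + 1) *
    ∑ i ∈ Finset.Icc (-(N : ℤ)) (N : ℤ), (-1 : ℝ) ^ i * (w i * ∏ j, w (i + m j))

/-- The `(k + 1)`-point correlation function of `w`. -/
noncomputable def eta (w : ℤ → ℝ) {k : ℕ} (m : Fin k → ℤ) : ℝ :=
  limUnder atTop (etaAvg w m)

/-- The signed `(k + 1)`-point correlation function of `w`. -/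
noncomputable def theta (w : ℤ → ℝ) {k : ℕ} (m : Fin k → ℤ) : ℝ :=
  limUnder atTop (thetaAvg w m)

end RudinShapiro

/-! The sequence `w` and its inflation `w'` satisfy `w (2 * i) = w' i` and `w (2 * i + 1) = (-1) ^ i
* w' i`, and the same with the roles exchanged. Splitting a four-point product by the parity of `i`
therefore gives, up to constant signs, the products of the other sequence at the shifts `m / 2` and
`(m + 1) / 2`, with an extra factor `(-1) ^ i` exactly when the sum of the shifts is odd
(`fourProd_dyadic`). So each plain or signed average is half of a signed sum of two averages at
smaller shifts.

The induction on the size of the shifts (`exists_hasAverage`) ends at shifts in `{-1, 0, 1}`. There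
a product is constantly one if the shifts `0, a, b, c` match in pairs, and otherwise reduces to a
two-point product of neighbours, whose averages vanish. Strict inequality survives each halving:
signed averages are always smaller than one in modulus, and plain averages of modulus one at both
halved triples force the original triple to be paired. -/

namespace RudinShapiro

/-! ### Averages over symmetric intervals and their dyadic renormalization. -/

/-- The sum of `f` over the integers `i` with `-N ≤ i < N`. -/
noncomputable def symSum (f : ℤ → ℝ) (N : ℕ) : ℝ :=
  ∑ i ∈ Finset.range N, (f i + f (-1 - i))

/-- `f` has average `a` over the symmetric intervals, in a form suited to estimates. -/
def HasAverage (f : ℤ → ℝ) (a : ℝ) : Prop :=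
  ∀ ε > 0, ∃ C : ℝ, ∀ N : ℕ, |symSum f N - 2 * a * N| ≤ ε * N + C

/-- The half-open interval `[-2n, 2n)` is exactly the union of the pairs `{2i, 2i + 1}` with `-n ≤ i
< n`, so there is no boundary term. -/
theorem symSum_two_mul (f : ℤ → ℝ) (n : ℕ) :
    symSum f (2 * n) = symSum (fun i => f (2 * i) + f (2 * i + 1)) n := by
  unfold symSum
  induction n with
  | zero => simp
  | succ n ih =>
    rw [show 2 * (n + 1) = 2 * n + 1 + 1 by ring, Finset.sum_range_succ, Finset.sum_range_succ,
      ih, Finset.sum_range_succ]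
    push_cast
    rw [show (2 * (-1 - (n : ℤ))) = -1 - (2 * n + 1) by ring,
      show (-1 - (2 * (n : ℤ) + 1)) + 1 = -1 - 2 * n by ring]
    ring

theorem abs_symSum_sub_le {f : ℤ → ℝ} (hf : ∀ i, |f i| ≤ 1) (N : ℕ) :
    |symSum f N - symSum (fun i => f (2 * i) + f (2 * i + 1)) (N / 2)| ≤ 2 := by
  rw [← symSum_two_mul]
  rcases Nat.even_or_odd' N with ⟨n, rfl | rfl⟩
  · simp
  · rw [show (2 * n + 1) / 2 = n by omega]
    have : symSum f (2 * n + 1) = symSum f (2 * n) + (f (2 * n : ℕ) + f (-1 - (2 * n : ℕ))) :=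
      Finset.sum_range_succ _ _
    rw [this, add_sub_cancel_left]
    have h1 := hf (2 * n : ℕ)
    have h2 := hf (-1 - (2 * n : ℕ))
    exact (abs_add_le _ _).trans (by linarith)

theorem abs_symSum_le {f : ℤ → ℝ} (hf : ∀ i, |f i| ≤ 1) (N : ℕ) : |symSum f N| ≤ 2 * N := by
  unfold symSum
  refine (Finset.abs_sum_le_sum_abs _ _).trans ?_
  calc _ ≤ ∑ i ∈ Finset.range N, (2 : ℝ) := Finset.sum_le_sum fun i _ =>
        (abs_add_le _ _).trans (by linarith [hf i, hf (-1 - i)])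
    _ = 2 * N := by simp [mul_comm]

theorem symSum_add (f g : ℤ → ℝ) (N : ℕ) :
    symSum (fun i => f i + g i) N = symSum f N + symSum g N := by
  unfold symSum
  rw [← Finset.sum_add_distrib]
  exact Finset.sum_congr rfl fun _ _ => by ring

theorem symSum_const_mul (c : ℝ) (f : ℤ → ℝ) (N : ℕ) :
    symSum (fun i => c * f i) N = c * symSum f N := by
  unfold symSum
  rw [Finset.mul_sum]
  exact Finset.sum_congr rfl fun _ _ => by ring

theorem HasAverage.add {f g : ℤ → ℝ} {a b : ℝ} (hf : HasAverage f a) (hg : HasAverage g b) :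
    HasAverage (fun i => f i + g i) (a + b) := by
  intro ε hε
  obtain ⟨C, hC⟩ := hf (ε / 2) (by positivity)
  obtain ⟨D, hD⟩ := hg (ε / 2) (by positivity)
  refine ⟨C + D, fun N => ?_⟩
  rw [symSum_add, show symSum f N + symSum g N - 2 * (a + b) * N =
    (symSum f N - 2 * a * N) + (symSum g N - 2 * b * N) by ring]
  exact (abs_add_le _ _).trans (by linarith [hC N, hD N])

theorem HasAverage.const_mul {f : ℤ → ℝ} {a : ℝ} (hf : HasAverage f a) (c : ℝ) :
    HasAverage (fun i => c * f i) (c * a) := by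
  intro ε hε
  -- The added `1` keeps the denominator positive when `c = 0`.
  obtain ⟨C, hC⟩ := hf (ε / (|c| + 1)) (by positivity)
  refine ⟨|c| * C, fun N => ?_⟩
  rw [symSum_const_mul, show c * symSum f N - 2 * (c * a) * N =
    c * (symSum f N - 2 * a * N) by ring, abs_mul]
  have h1 : |c| * (ε / (|c| + 1)) ≤ ε := by
    rw [mul_div_assoc', div_le_iff₀ (by positivity)]
    nlinarith [abs_nonneg c]
  calc |c| * |symSum f N - 2 * a * N| ≤ |c| * (ε / (|c| + 1) * N + C) :=
        mul_le_mul_of_nonneg_left (hC N) (abs_nonneg c)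
    _ = |c| * (ε / (|c| + 1)) * N + |c| * C := by ring
    _ ≤ ε * N + |c| * C := by gcongr

theorem hasAverage_const (c : ℝ) : HasAverage (fun _ => c) c := by
  refine fun ε hε => ⟨0, fun N => ?_⟩
  have : symSum (fun _ => c) N - 2 * c * N = 0 := by
    simp only [symSum, Finset.sum_const, Finset.card_range, nsmul_eq_mul]
    ring
  rw [this, abs_zero]
  positivity

theorem nat_half_le (N : ℕ) : (N : ℝ) / 2 - 1 / 2 ≤ (N / 2 : ℕ) ∧ ((N / 2 : ℕ) : ℝ) ≤ N / 2 := by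
  have h1 : N ≤ 2 * (N / 2) + 1 := by omega
  have h2 : 2 * (N / 2) ≤ N := by omega
  have h1' : (N : ℝ) ≤ 2 * (N / 2 : ℕ) + 1 := by exact_mod_cast h1
  have h2' : 2 * ((N / 2 : ℕ) : ℝ) ≤ N := by exact_mod_cast h2
  constructor <;> linarith

theorem HasAverage.of_dyadic {f : ℤ → ℝ} {c : ℝ} (hf : ∀ i, |f i| ≤ 1)
    (h : HasAverage (fun i => f (2 * i) + f (2 * i + 1)) c) : HasAverage f (c / 2) := by
  intro ε hε
  obtain ⟨C, hC⟩ := h ε hε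
  refine ⟨C + 2 + |c|, fun N => ?_⟩
  obtain ⟨h1, h2⟩ := nat_half_le N
  have h3 := abs_symSum_sub_le hf N
  have h4 := hC (N / 2)
  have h5 : |2 * c * ((N / 2 : ℕ) : ℝ) - c * N| ≤ |c| := by
    rw [show 2 * c * ((N / 2 : ℕ) : ℝ) - c * N = c * (2 * ((N / 2 : ℕ) : ℝ) - N) by ring, abs_mul]
    refine mul_le_of_le_one_right (abs_nonneg c) (abs_le.2 ⟨?_, ?_⟩) <;> linarith
  have h6 : ε * ((N / 2 : ℕ) : ℝ) ≤ ε * N :=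
    mul_le_mul_of_nonneg_left (by linarith [(Nat.cast_nonneg N : (0 : ℝ) ≤ N)]) hε.le
  rw [abs_le] at *
  constructor <;> linarith [h3.1, h3.2, h4.1, h4.2, h5.1, h5.2]

/-- If two bounded functions renormalize into each other with a contraction factor `1 / 2`, up to
terms of zero average, then their averages vanish. -/
theorem hasAverage_zero_of_dyadic {f f' g g' : ℤ → ℝ} {s s' : ℝ}
    (hf : ∀ i, |f i| ≤ 1) (hf' : ∀ i, |f' i| ≤ 1) (hs : |s| ≤ 1) (hs' : |s'| ≤ 1)
    (hg : HasAverage g 0) (hg' : HasAverage g' 0)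
    (h : ∀ i, f (2 * i) + f (2 * i + 1) = g i + s * f' i)
    (h' : ∀ i, f' (2 * i) + f' (2 * i + 1) = g' i + s' * f i) : HasAverage f 0 := by
  -- The averages are not yet known to exist, so upper bounds on the growth rate are iterated
  -- instead of solving the linear equations for the limits.
  have key : ∀ {f f' g : ℤ → ℝ} {s ε δ C D : ℝ}, 0 ≤ ε → 0 ≤ δ →
      (∀ i, |f i| ≤ 1) → |s| ≤ 1 → (∀ i, f (2 * i) + f (2 * i + 1) = g i + s * f' i) →
      (∀ N : ℕ, |symSum g N - 2 * 0 * N| ≤ ε * N + C) →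
      (∀ N : ℕ, |symSum f' N| ≤ δ * N + D) →
      ∀ N : ℕ, |symSum f N| ≤ (ε + δ) / 2 * N + (C + D + 2) := by
    intro f f' g s ε δ C D hε hδ hf hs h hg hf' N
    obtain ⟨-, h2⟩ := nat_half_le N
    have h3 := abs_symSum_sub_le hf N
    rw [show (fun i => f (2 * i) + f (2 * i + 1)) = fun i => g i + s * f' i from funext h,
      symSum_add, symSum_const_mul] at h3
    have h4 := hg (N / 2)
    have h5 := hf' (N / 2)
    have h6 : |s * symSum f' (N / 2)| ≤ |symSum f' (N / 2)| := by
      rw [abs_mul]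
      exact mul_le_of_le_one_left (abs_nonneg _) hs
    have h7 : (ε + δ) * ((N / 2 : ℕ) : ℝ) ≤ (ε + δ) * (N / 2) :=
      mul_le_mul_of_nonneg_left h2 (by linarith)
    have h8 := h6.trans h5
    rw [abs_le] at *
    constructor <;> linarith [h3.1, h3.2, h4.1, h4.2, h8.1, h8.2]
  intro ε hε
  obtain ⟨C, hC⟩ := hg (ε / 2) (by positivity)
  obtain ⟨C', hC'⟩ := hg' (ε / 2) (by positivity)
  -- The rate starts from the trivial bound `2`; the map `δ ↦ (ε / 2 + δ) / 2` fixes `ε / 2` and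
  -- halves the distance to it.
  have iter : ∀ k : ℕ, ∃ D D' : ℝ,
      (∀ N : ℕ, |symSum f N| ≤ (ε / 2 + 2 * (1 / 2) ^ k) * N + D) ∧
      (∀ N : ℕ, |symSum f' N| ≤ (ε / 2 + 2 * (1 / 2) ^ k) * N + D') := by
    intro k
    induction k with
    | zero =>
      refine ⟨0, 0, fun N => (abs_symSum_le hf N).trans ?_,
        fun N => (abs_symSum_le hf' N).trans ?_⟩ <;>
      · have : 0 ≤ ε / 2 * N := by positivity
        linarith
    | succ k ih =>
      obtain ⟨D, D', hD, hD'⟩ := ih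
      refine ⟨C + D' + 2, C' + D + 2, fun N => ?_, fun N => ?_⟩
      · refine (key (by positivity) (by positivity) hf hs h hC hD' N).trans (le_of_eq ?_)
        ring
      · refine (key (by positivity) (by positivity) hf' hs' h' hC' hD N).trans (le_of_eq ?_)
        ring
  obtain ⟨k, hk⟩ := exists_pow_lt_of_lt_one (show 0 < ε / 4 by positivity)
    (show (1 / 2 : ℝ) < 1 by norm_num)
  obtain ⟨D, -, hD, -⟩ := iter k
  refine ⟨D, fun N => ?_⟩
  rw [show symSum f N - 2 * 0 * N = symSum f N by ring]
  refine (hD N).trans ?_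
  gcongr
  linarith

theorem sum_Icc_eq_symSum (f : ℤ → ℝ) (N : ℕ) :
    ∑ i ∈ Finset.Icc (-(N : ℤ)) N, f i = symSum f N + f N := by
  induction N with
  | zero => simp [symSum]
  | succ n ih =>
    have hI : Finset.Icc (-((n + 1 : ℕ) : ℤ)) ((n + 1 : ℕ) : ℤ) =
        insert (-1 - (n : ℤ)) (insert ((n : ℤ) + 1) (Finset.Icc (-(n : ℤ)) n)) := by
      ext x
      simp only [Finset.mem_Icc, Finset.mem_insert]
      push_cast
      omega
    rw [hI, Finset.sum_insert, Finset.sum_insert, ih]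
    · simp only [symSum, Finset.sum_range_succ]
      push_cast
      ring
    · simp
    · simp only [Finset.mem_Icc, Finset.mem_insert]
      omega

theorem HasAverage.tendsto {f : ℤ → ℝ} {a : ℝ} (hf : ∀ i, |f i| ≤ 1) (h : HasAverage f a) :
    Tendsto (fun N : ℕ => 1 / (2 * (N : ℝ) + 1) * ∑ i ∈ Finset.Icc (-(N : ℤ)) (N : ℤ), f i)
      atTop (𝓝 a) := by
  rw [Metric.tendsto_atTop]
  intro ε hε
  obtain ⟨C, hC⟩ := h ε hε
  obtain ⟨M, hM⟩ := exists_nat_gt ((C + 1 + |a|) / ε)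
  refine ⟨M, fun N hN => ?_⟩
  have hN' : (M : ℝ) ≤ N := by exact_mod_cast hN
  have hpos : (0 : ℝ) < 2 * N + 1 := by positivity
  rw [Real.dist_eq, sum_Icc_eq_symSum, show 1 / (2 * (N : ℝ) + 1) * (symSum f N + f N) - a =
    ((symSum f N - 2 * a * N) + f N - a) / (2 * N + 1) by field_simp; ring, abs_div,
    abs_of_pos hpos, div_lt_iff₀ hpos]
  -- The closed interval has one more point than the half-open one, which costs only a bounded
  -- error.
  have h1 : |(symSum f N - 2 * a * N) + f N - a| ≤ (ε * N + C) + 1 + |a| := by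
    refine (abs_sub _ _).trans ?_
    linarith [abs_add_le (symSum f N - 2 * a * N) (f N), hC N, hf N]
  have h2 : C + 1 + |a| < ε * N := by
    rw [div_lt_iff₀ hε] at hM
    nlinarith
  linarith

/-- Multiplication by the alternating sign. -/
noncomputable def alternate (f : ℤ → ℝ) (i : ℤ) : ℝ := (-1 : ℝ) ^ i * f i

theorem neg_one_zpow_two_mul (i : ℤ) : (-1 : ℝ) ^ (2 * i) = 1 :=
  (even_two_mul i).neg_one_zpow

theorem neg_one_zpow_add_one (i : ℤ) : (-1 : ℝ) ^ (i + 1) = -(-1) ^ i := by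
  rw [zpow_add₀ (by norm_num)]; simp

theorem neg_one_zpow_sub_one (i : ℤ) : (-1 : ℝ) ^ (i - 1) = -(-1) ^ i := by
  rw [zpow_sub₀ (by norm_num), zpow_one, div_neg, div_one]

theorem neg_one_zpow_mul_self (i : ℤ) : (-1 : ℝ) ^ i * (-1) ^ i = 1 := by
  rw [← zpow_add₀ (by norm_num), ← two_mul, neg_one_zpow_two_mul]

theorem neg_one_zpow_two_mul_add_one (i : ℤ) : (-1 : ℝ) ^ (2 * i + 1) = -1 := by
  rw [neg_one_zpow_add_one, neg_one_zpow_two_mul]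

theorem abs_alternate (f : ℤ → ℝ) (i : ℤ) : |alternate f i| = |f i| := by
  simp [alternate, abs_mul, abs_zpow]

theorem hasAverage_neg_one_zpow : HasAverage (fun i => (-1 : ℝ) ^ i) 0 := by
  have h := HasAverage.of_dyadic (f := fun i => (-1 : ℝ) ^ i) (c := 0)
    (fun i => by simp [abs_zpow]) (by
      simpa only [neg_one_zpow_two_mul, neg_one_zpow_two_mul_add_one, add_neg_cancel]
        using hasAverage_const 0)
  simpa using h

/-! ### Two-point averages at small distance for an inflation pair. -/

/-- Two `±1`-valued sequences that are the inflations of each other, in terms of the reduced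
binary sequences. -/
structure IsInflationPair (w w' : ℤ → ℝ) : Prop where
  sq : ∀ i, w i * w i = 1
  sq' : ∀ i, w' i * w' i = 1
  even : ∀ i, w (2 * i) = w' i
  odd : ∀ i, w (2 * i + 1) = (-1) ^ i * w' i
  even' : ∀ i, w' (2 * i) = w i
  odd' : ∀ i, w' (2 * i + 1) = (-1) ^ i * w i

namespace IsInflationPair

variable {w w' : ℤ → ℝ}

theorem symm (h : IsInflationPair w w') : IsInflationPair w' w :=
  ⟨h.sq', h.sq, h.even', h.odd', h.even, h.odd⟩

theorem abs_eq (h : IsInflationPair w w') (i : ℤ) : |w i| = 1 := by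
  have := h.sq i
  rw [← abs_mul_abs_self] at this
  nlinarith [abs_nonneg (w i)]

theorem abs_mul_le (h : IsInflationPair w w') (i j : ℤ) : |w i * w j| ≤ 1 := by
  rw [abs_mul, h.abs_eq, h.abs_eq, one_mul]

/-- The signed product renormalizes into minus the same product for the other sequence, plus `(-1) ^
i`, so halving the scale contracts the average to zero. -/
theorem alternate_next (h : IsInflationPair w w') :
    HasAverage (alternate fun i => w i * w (i + 1)) 0 := by
  have step : ∀ {w w' : ℤ → ℝ}, IsInflationPair w w' → ∀ i,
      alternate (fun i => w i * w (i + 1)) (2 * i) +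
        alternate (fun i => w i * w (i + 1)) (2 * i + 1) =
      (-1) ^ i + (-1) * alternate (fun i => w' i * w' (i + 1)) i := by
    intro w w' h i
    simp only [alternate, neg_one_zpow_two_mul, neg_one_zpow_two_mul_add_one]
    rw [show 2 * i + 1 + 1 = 2 * (i + 1) by ring, h.even, h.even, h.odd]
    linear_combination (-1) ^ i * h.sq' i
  refine hasAverage_zero_of_dyadic (f' := alternate fun i => w' i * w' (i + 1))
    ?_ ?_ ?_ ?_ hasAverage_neg_one_zpow hasAverage_neg_one_zpow (step h) (step h.symm)
  · intro i; rw [abs_alternate]; exact h.abs_mul_le _ _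
  · intro i; rw [abs_alternate]; exact h.symm.abs_mul_le _ _
  · simp
  · simp

theorem next (h : IsInflationPair w w') : HasAverage (fun i => w i * w (i + 1)) 0 := by
  have := HasAverage.of_dyadic (f := fun i => w i * w (i + 1)) (c := 0 + 0)
    (fun i => h.abs_mul_le _ _) (by
      convert hasAverage_neg_one_zpow.add h.symm.alternate_next using 2 with i
      rw [show 2 * i + 1 + 1 = 2 * (i + 1) by ring, h.even, h.even, h.odd, alternate]
      linear_combination (-1) ^ i * h.sq' i)
  simpa using this

theorem odd_pred (h : IsInflationPair w w') (i : ℤ) :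
    w (2 * i - 1) = -(-1) ^ i * w' (i - 1) := by
  rw [show 2 * i - 1 = 2 * (i - 1) + 1 by ring, h.odd, neg_one_zpow_sub_one]

theorem alternate_prev (h : IsInflationPair w w') :
    HasAverage (alternate fun i => w i * w (i - 1)) 0 := by
  have step : ∀ {w w' : ℤ → ℝ}, IsInflationPair w w' → ∀ i,
      alternate (fun i => w i * w (i - 1)) (2 * i) +
        alternate (fun i => w i * w (i - 1)) (2 * i + 1) =
      (-1) * (-1) ^ i + (-1) * alternate (fun i => w' i * w' (i - 1)) i := by
    intro w w' h i
    simp only [alternate, neg_one_zpow_two_mul, neg_one_zpow_two_mul_add_one]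
    rw [add_sub_cancel_right, h.even, h.odd, h.odd_pred]
    linear_combination -(-1) ^ i * h.sq' i
  have hg := hasAverage_neg_one_zpow.const_mul (-1)
  rw [mul_zero] at hg
  refine hasAverage_zero_of_dyadic (f' := alternate fun i => w' i * w' (i - 1))
    ?_ ?_ ?_ ?_ hg hg (step h) (step h.symm)
  · intro i; rw [abs_alternate]; exact h.abs_mul_le _ _
  · intro i; rw [abs_alternate]; exact h.symm.abs_mul_le _ _
  · simp
  · simp

theorem prev (h : IsInflationPair w w') : HasAverage (fun i => w i * w (i - 1)) 0 := by
  have := HasAverage.of_dyadic (f := fun i => w i * w (i - 1)) (c := 0 + -1 * 0)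
    (fun i => h.abs_mul_le _ _) (by
      convert hasAverage_neg_one_zpow.add (h.symm.alternate_prev.const_mul (-1)) using 2 with i
      rw [add_sub_cancel_right, h.even, h.odd, h.odd_pred, alternate]
      linear_combination (-1) ^ i * h.sq' i)
  simpa using this

/-- At odd positions of `w` the two alternating signs cancel up to a constant, so plain
nearest-neighbour products of `w'` remain. -/
theorem neighbours (h : IsInflationPair w w') :
    HasAverage (fun i => w (i + 1) * w (i - 1)) 0 := by
  have := HasAverage.of_dyadic (f := fun i => w (i + 1) * w (i - 1)) (c := 0 + -1 * 0)
    (fun i => h.abs_mul_le _ _) (by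
      convert h.symm.next.add (h.symm.prev.const_mul (-1)) using 2 with i
      rw [show 2 * i + 1 + 1 = 2 * (i + 1) by ring, add_sub_cancel_right, h.even, h.even, h.odd,
        h.odd_pred]
      linear_combination -(w' i * w' (i - 1)) * neg_one_zpow_mul_self i)
  simpa using this

theorem alternate_neighbours (h : IsInflationPair w w') :
    HasAverage (alternate fun i => w (i + 1) * w (i - 1)) 0 := by
  have := HasAverage.of_dyadic (f := alternate fun i => w (i + 1) * w (i - 1))
    (c := -1 * 0 + -1 * 0)
    (fun i => by rw [abs_alternate]; exact h.abs_mul_le _ _) (by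
      convert (h.symm.next.const_mul (-1)).add (h.symm.prev.const_mul (-1)) using 2 with i
      simp only [alternate, neg_one_zpow_two_mul, neg_one_zpow_two_mul_add_one]
      rw [show 2 * i + 1 + 1 = 2 * (i + 1) by ring, add_sub_cancel_right, h.even, h.even, h.odd,
        h.odd_pred]
      linear_combination -(w' i * w' (i - 1)) * neg_one_zpow_mul_self i)
  simpa using this

end IsInflationPair

/-! ### Four-point products and the induction on the shifts. -/

/-- The four-point products. -/
def fourProd (w : ℤ → ℝ) (a b c i : ℤ) : ℝ := w i * (w (i + a) * w (i + b) * w (i + c))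

/-- The four shifts `0, a, b, c` can be matched into two equal pairs. -/
def IsPaired (a b c : ℤ) : Prop := a = 0 ∧ b = c ∨ b = 0 ∧ a = c ∨ c = 0 ∧ a = b

namespace IsInflationPair

variable {w w' : ℤ → ℝ}

theorem abs_fourProd (h : IsInflationPair w w') (a b c i : ℤ) : |fourProd w a b c i| = 1 := by
  simp [fourProd, abs_mul, h.abs_eq]

theorem fourProd_eq_one (h : IsInflationPair w w') {a b c : ℤ} (hp : IsPaired a b c) :
    fourProd w a b c = fun _ => 1 := by
  funext i
  unfold fourProd
  rcases hp with ⟨rfl, rfl⟩ | ⟨rfl, rfl⟩ | ⟨rfl, rfl⟩ <;> rw [add_zero]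
  · linear_combination w (i + b) * w (i + b) * h.sq i + h.sq (i + b)
  · linear_combination w (i + a) * w (i + a) * h.sq i + h.sq (i + a)
  · linear_combination w (i + a) * w (i + a) * h.sq i + h.sq (i + a)

/-- Equal factors cancel because `w` takes the values `±1`. Four unpaired points among three
positions leave exactly two distinct ones. -/
theorem fourProd_small (h : IsInflationPair w w') {a b c : ℤ} (ha : a = -1 ∨ a = 0 ∨ a = 1)
    (hb : b = -1 ∨ b = 0 ∨ b = 1) (hc : c = -1 ∨ c = 0 ∨ c = 1) (hp : ¬ IsPaired a b c) :
    fourProd w a b c = (fun i => w i * w (i + 1)) ∨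
    fourProd w a b c = (fun i => w i * w (i - 1)) ∨
    fourProd w a b c = (fun i => w (i + 1) * w (i - 1)) := by
  have hw : ∀ i, w i = 1 ∨ w i = -1 := fun i => mul_self_eq_one_iff.1 (h.sq i)
  have ext : ∀ {f g : ℤ → ℝ}, (∀ i, w i = 1 ∨ w i = -1 → w (i + 1) = 1 ∨ w (i + 1) = -1 →
      w (i - 1) = 1 ∨ w (i - 1) = -1 → f i = g i) → f = g :=
    fun H => funext fun i => H i (hw i) (hw (i + 1)) (hw (i - 1))
  rcases ha with rfl | rfl | rfl <;> rcases hb with rfl | rfl | rfl <;>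
    rcases hc with rfl | rfl | rfl <;>
    first
    | exact absurd (by unfold IsPaired; omega) hp
    | (left; refine ext fun i h0 h1 h2 => ?_
       simp only [fourProd, add_zero, ← sub_eq_add_neg]
       rcases h0 with h0 | h0 <;> rcases h1 with h1 | h1 <;> rcases h2 with h2 | h2 <;>
         simp only [h0, h1, h2] <;> norm_num <;> done)
    | (right; left; refine ext fun i h0 h1 h2 => ?_
       simp only [fourProd, add_zero, ← sub_eq_add_neg]
       rcases h0 with h0 | h0 <;> rcases h1 with h1 | h1 <;> rcases h2 with h2 | h2 <;>
         simp only [h0, h1, h2] <;> norm_num <;> done)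
    | (right; right; refine ext fun i h0 h1 h2 => ?_
       simp only [fourProd, add_zero, ← sub_eq_add_neg]
       rcases h0 with h0 | h0 <;> rcases h1 with h1 | h1 <;> rcases h2 with h2 | h2 <;>
         simp only [h0, h1, h2] <;> norm_num)

theorem apply_two_mul_add (h : IsInflationPair w w') (m : ℤ) : ∃ s : ℝ, |s| = 1 ∧
    (Even m → ∀ i, w (2 * i + m) = s * w' (i + m / 2)) ∧
    (¬ Even m → ∀ i, w (2 * i + m) = s * ((-1) ^ i * w' (i + m / 2))) := by
  by_cases hm : Even m
  · refine ⟨1, by simp, fun _ i => ?_, fun h => absurd hm h⟩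
    rw [one_mul, ← h.even]
    congr 1
    have := Int.even_iff.1 hm
    omega
  · refine ⟨(-1) ^ (m / 2), by simp [abs_zpow], fun h => absurd h hm, fun _ i => ?_⟩
    have h1 : 2 * i + m = 2 * (i + m / 2) + 1 := by
      rw [Int.not_even_iff] at hm
      omega
    rw [h1, h.odd, zpow_add₀ (by norm_num)]
    ring

/-- Each factor at an odd position contributes one `(-1) ^ i`. Passing from `2 * i` to `2 * i + 1`
exchanges odd and even positions among four factors, so the parity of their number is the same in
both cases. -/
theorem fourProd_dyadic (h : IsInflationPair w w') (a b c : ℤ) : ∃ s t : ℝ, |s| = 1 ∧ |t| = 1 ∧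
    (Even (a + b + c) →
      (∀ i, fourProd w a b c (2 * i) = s * fourProd w' (a / 2) (b / 2) (c / 2) i) ∧
      (∀ i, fourProd w a b c (2 * i + 1) =
        t * fourProd w' ((a + 1) / 2) ((b + 1) / 2) ((c + 1) / 2) i)) ∧
    (¬ Even (a + b + c) →
      (∀ i, fourProd w a b c (2 * i) = s * alternate (fourProd w' (a / 2) (b / 2) (c / 2)) i) ∧
      (∀ i, fourProd w a b c (2 * i + 1) =
        t * alternate (fourProd w' ((a + 1) / 2) ((b + 1) / 2) ((c + 1) / 2)) i)) := by
  obtain ⟨s₁, hs₁, e₁, o₁⟩ := h.apply_two_mul_add a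
  obtain ⟨s₂, hs₂, e₂, o₂⟩ := h.apply_two_mul_add b
  obtain ⟨s₃, hs₃, e₃, o₃⟩ := h.apply_two_mul_add c
  obtain ⟨t₁, ht₁, e₁', o₁'⟩ := h.apply_two_mul_add (a + 1)
  obtain ⟨t₂, ht₂, e₂', o₂'⟩ := h.apply_two_mul_add (b + 1)
  obtain ⟨t₃, ht₃, e₃', o₃'⟩ := h.apply_two_mul_add (c + 1)
  refine ⟨s₁ * s₂ * s₃, t₁ * t₂ * t₃, by simp [abs_mul, *], by simp [abs_mul, *], ?_⟩
  have hE : ∀ m : ℤ, Even (m + 1) ↔ ¬ Even m := fun m => Int.even_add_one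
  have hsh : ∀ i m : ℤ, 2 * i + 1 + m = 2 * i + (m + 1) := fun i m => by ring
  by_cases ha : Even a <;> by_cases hb : Even b <;> by_cases hc : Even c <;>
    simp only [hE, Int.even_add, ha, hb, hc, fourProd, alternate, hsh, not_true_eq_false,
      not_false_eq_true, forall_const, false_imp_iff, true_and, and_true, iff_true, iff_false,
      iff_self] at * <;>
    refine ⟨fun i => ?_, fun i => ?_⟩ <;>
    rcases mul_self_eq_one_iff.1 (neg_one_zpow_mul_self i) with hi | hi <;>
    simp only [h.even, h.odd, *] <;>
    ring

theorem exists_hasAverage (R : ℕ) : ∀ {w w' : ℤ → ℝ} {a b c : ℤ}, IsInflationPair w w' →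
    |a| ≤ R → |b| ≤ R → |c| ≤ R → ∃ x y : ℝ,
      HasAverage (fourProd w a b c) x ∧ HasAverage (alternate (fourProd w a b c)) y ∧
      |x| ≤ 1 ∧ |y| < 1 ∧ (IsPaired a b c → x = 1) ∧ (¬ IsPaired a b c → |x| < 1) := by
  induction R using Nat.strong_induction_on with
  | _ R ih =>
  intro w w' a b c h ha hb hc
  by_cases hp : IsPaired a b c
  · rw [h.fourProd_eq_one hp]
    refine ⟨1, 0, hasAverage_const 1, ?_, by simp, by simp, fun _ => rfl, fun h => absurd hp h⟩
    rw [show alternate (fun _ => 1) = fun i => (-1) ^ i from funext fun _ => mul_one _]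
    exact hasAverage_neg_one_zpow
  rw [abs_le] at ha hb hc
  -- The halved shifts are bounded by `(R + 1) / 2`, which is smaller than `R` only for `R > 1`.
  rcases le_or_gt R 1 with hR | hR
  · refine ⟨0, 0, ?_, ?_, by simp, by simp, fun h => absurd h hp, fun _ => by simp⟩ <;>
    rcases h.fourProd_small (a := a) (b := b) (c := c) (by omega) (by omega) (by omega) hp
      with he | he | he <;> rw [he]
    exacts [h.next, h.prev, h.neighbours, h.alternate_next, h.alternate_prev,
      h.alternate_neighbours]
  have half : ∀ m : ℤ, -(R : ℤ) ≤ m ∧ m ≤ R →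
      |m / 2| ≤ ((R + 1) / 2 : ℕ) ∧ |(m + 1) / 2| ≤ ((R + 1) / 2 : ℕ) := by
    intro m hm
    rw [abs_le, abs_le]
    omega
  obtain ⟨x, y, hx, hy, hx1, hy1, -, hxp⟩ := ih ((R + 1) / 2) (by omega) h.symm
    (half a ha).1 (half b hb).1 (half c hc).1
  obtain ⟨x', y', hx', hy', hx1', hy1', -, hxp'⟩ := ih ((R + 1) / 2) (by omega) h.symm
    (half a ha).2 (half b hb).2 (half c hc).2
  obtain ⟨s, t, hs, ht, he, ho⟩ := h.fourProd_dyadic a b c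
  have bound : ∀ i, |fourProd w a b c i| ≤ 1 := fun i => (h.abs_fourProd a b c i).le
  have bound' : ∀ i, |alternate (fourProd w a b c) i| ≤ 1 := fun i => by
    rw [abs_alternate]; exact bound i
  -- The alternating sign only flips the contribution of the odd positions, so one computation
  -- yields both averages.
  have main : ∀ {F G : ℤ → ℝ} {p q : ℝ}, HasAverage F p → HasAverage G q →
      (∀ i, fourProd w a b c (2 * i) = s * F i) → (∀ i, fourProd w a b c (2 * i + 1) = t * G i) →
      HasAverage (fourProd w a b c) ((s * p + t * q) / 2) ∧
      HasAverage (alternate (fourProd w a b c)) ((s * p + -t * q) / 2) := by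
    intro F G p q hF hG h0 h1
    refine ⟨HasAverage.of_dyadic bound ?_, HasAverage.of_dyadic bound' ?_⟩
    · simp only [h0, h1]
      exact (hF.const_mul s).add (hG.const_mul t)
    · convert (hF.const_mul s).add (hG.const_mul (-t)) using 2 with i
      simp only [alternate, neg_one_zpow_two_mul, neg_one_zpow_two_mul_add_one, h0, h1]
      ring
  have lt_one : ∀ {r p q : ℝ}, |r| = 1 → |p| ≤ 1 → |q| ≤ 1 → (|p| < 1 ∨ |q| < 1) →
      |(s * p + r * q) / 2| < 1 := by
    intro r p q hr h1 h2 h3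
    rw [abs_div, abs_two, div_lt_one two_pos]
    refine (abs_add_le _ _).trans_lt ?_
    rw [abs_mul, abs_mul, hs, hr]
    rcases h3 with h3 | h3 <;> linarith
  have ht' : |-t| = 1 := by rwa [abs_neg]
  by_cases hpar : Even (a + b + c)
  · obtain ⟨h1, h2⟩ := main hx hx' (he hpar).1 (he hpar).2
    have hlt : |x| < 1 ∨ |x'| < 1 := by
      by_contra! hcon
      have p1 : IsPaired (a / 2) (b / 2) (c / 2) := by
        by_contra h; exact absurd (hxp h) (not_lt.2 hcon.1)
      have p2 : IsPaired ((a + 1) / 2) ((b + 1) / 2) ((c + 1) / 2) := by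
        by_contra h; exact absurd (hxp' h) (not_lt.2 hcon.2)
      have := Int.even_iff.1 hpar
      unfold IsPaired at hp p1 p2
      omega
    exact ⟨_, _, h1, h2, (lt_one ht hx1 hx1' hlt).le, lt_one ht' hx1 hx1' hlt,
      fun h => absurd h hp, fun _ => lt_one ht hx1 hx1' hlt⟩
  · obtain ⟨h1, h2⟩ := main hy hy' (ho hpar).1 (ho hpar).2
    -- For odd sum of shifts only signed averages enter, and these are strictly below one even at
    -- paired shifts.
    have hlt := lt_one ht hy1.le hy1'.le (Or.inl hy1)
    exact ⟨_, _, h1, h2, hlt.le, lt_one ht' hy1.le hy1'.le (Or.inl hy1),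
      fun h => absurd h hp, fun _ => hlt⟩

end IsInflationPair

/-! ### From the quaternary substitution to an inflation pair. -/

theorem inflate_two_mul (u : ℤ → Fin 4) (i : ℤ) : inflate u (2 * i) = subst (u i) 0 := by
  unfold inflate
  rw [if_pos (even_two_mul i), show 2 * i / 2 = i by omega]

theorem inflate_two_mul_add_one (u : ℤ → Fin 4) (i : ℤ) :
    inflate u (2 * i + 1) = subst (u i) 1 := by
  unfold inflate
  rw [if_neg (by simp), show (2 * i + 1) / 2 = i by omega]

theorem weight_mul_self (x : Fin 4) : weight x * weight x = 1 := by
  fin_cases x <;> simp [weight]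

theorem weight_subst_zero (x : Fin 4) : weight (subst x 0) = weight x := by
  fin_cases x <;> simp [weight, subst]

/-- In an inflated word even positions carry `0` or `3` and odd positions `1` or `2`. The second
letter of the image keeps the weight of the former and reverses that of the latter, which is the
source of the sign `(-1) ^ i`. -/
theorem weight_subst_subst_one (x : Fin 4) :
    weight (subst (subst x 0) 1) = weight (subst x 0) ∧
    weight (subst (subst x 1) 1) = -weight (subst x 1) := by
  fin_cases x <;> simp [weight, subst]

theorem weight_inflate_inflate_odd (u : ℤ → Fin 4) (i : ℤ) :
    weight (inflate (inflate u) (2 * i + 1)) = (-1) ^ i * weight (inflate u i) := by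
  rw [inflate_two_mul_add_one]
  rcases Int.even_or_odd' i with ⟨j, rfl | rfl⟩
  · rw [inflate_two_mul, (weight_subst_subst_one _).1, neg_one_zpow_two_mul, one_mul]
  · rw [inflate_two_mul_add_one, (weight_subst_subst_one _).2, neg_one_zpow_two_mul_add_one,
      neg_one_mul]

theorem IsBalanced.exists_isInflationPair {w : ℤ → ℝ} (hw : IsBalanced w) :
    ∃ w', IsInflationPair w w' := by
  obtain ⟨u, ⟨hu, -⟩, rfl⟩ := hw
  have hu' : inflate (inflate u) = u := hu
  -- As `u` is fixed by the square of the inflation, `u` and `inflate u` are inflations of each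
  -- other.
  refine ⟨weight ∘ inflate u, fun i => weight_mul_self _, fun i => weight_mul_self _,
    fun i => ?_, fun i => ?_, fun i => ?_, fun i => ?_⟩
  · have := inflate_two_mul (inflate u) i
    rw [hu'] at this
    simp only [Function.comp_apply, this, weight_subst_zero]
  · have := weight_inflate_inflate_odd u i
    rwa [hu'] at this
  · simp only [Function.comp_apply, inflate_two_mul, weight_subst_zero]
  · have := weight_inflate_inflate_odd (inflate u) i
    rwa [hu'] at this

/-! ### Translation to the limits and permutations of the statement. -/

theorem isPaired_iff_exists_perm (m : Fin 3 → ℤ) : IsPaired (m 0) (m 1) (m 2) ↔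
    ∃ σ : Equiv.Perm (Fin 3), m (σ 0) = 0 ∧ m (σ 1) = m (σ 2) := by
  constructor
  · rintro (⟨h1, h2⟩ | ⟨h1, h2⟩ | ⟨h1, h2⟩)
    · exact ⟨1, h1, h2⟩
    · exact ⟨Equiv.swap 0 1, by simpa using h1, h2⟩
    · exact ⟨Equiv.swap 0 2, by simpa using h1, h2.symm⟩
  · rintro ⟨σ, h1, h2⟩
    have h01 : σ 0 ≠ σ 1 := σ.injective.ne (by decide)
    have h02 : σ 0 ≠ σ 2 := σ.injective.ne (by decide)
    have h12 : σ 1 ≠ σ 2 := σ.injective.ne (by decide)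
    unfold IsPaired
    generalize σ 0 = x at *
    generalize σ 1 = y at *
    generalize σ 2 = z at *
    fin_cases x <;> fin_cases y <;> fin_cases z <;> simp_all

theorem IsInflationPair.exists_tendsto {w w' : ℤ → ℝ} (h : IsInflationPair w w')
    (m : Fin 3 → ℤ) : ∃ x y : ℝ,
      Tendsto (etaAvg w m) atTop (𝓝 x) ∧ Tendsto (thetaAvg w m) atTop (𝓝 y) ∧
      |y| < 1 ∧ (x = 1 ↔ IsPaired (m 0) (m 1) (m 2)) := by
  obtain ⟨x, y, hx, hy, -, hy1, hp, hnp⟩ := IsInflationPair.exists_hasAverage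
    (max (m 0).natAbs (max (m 1).natAbs (m 2).natAbs)) h (a := m 0) (b := m 1) (c := m 2)
    (by rw [abs_le]; omega) (by rw [abs_le]; omega) (by rw [abs_le]; omega)
  have hb : ∀ i, |fourProd w (m 0) (m 1) (m 2) i| ≤ 1 := fun i => (h.abs_fourProd _ _ _ i).le
  refine ⟨x, y, ?_, ?_, hy1, fun hx1 => ?_, hp⟩
  · convert hx.tendsto hb using 2 with N
    simp only [etaAvg, Fin.prod_univ_three, fourProd]
  · convert hy.tendsto (fun i => by rw [abs_alternate]; exact hb i) using 2 with N
    simp only [thetaAvg, Fin.prod_univ_three, alternate, fourProd]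
  · by_contra hcon
    have := hnp hcon
    simp [hx1] at this

end RudinShapiro

theorem mainTheorem5 (w : ℤ → ℝ) (hw : RudinShapiro.IsBalanced w) :
    (∀ m : Fin 3 → ℤ,
      Tendsto (RudinShapiro.etaAvg w m) atTop (𝓝 (RudinShapiro.eta w m)) ∧
      Tendsto (RudinShapiro.thetaAvg w m) atTop (𝓝 (RudinShapiro.theta w m))) ∧
    (∀ m : Fin 3 → ℤ,
      RudinShapiro.eta w m = 1 ↔
        ∃ σ : Equiv.Perm (Fin 3), m (σ 0) = 0 ∧ m (σ 1) = m (σ 2)) ∧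
    (∀ m : Fin 3 → ℤ, |RudinShapiro.theta w m| < 1) := by
  obtain ⟨w', h⟩ := hw.exists_isInflationPair
  refine ⟨fun m => ?_, fun m => ?_, fun m => ?_⟩ <;>
    obtain ⟨x, y, hx, hy, hy1, hp⟩ := h.exists_tendsto m
  · exact ⟨tendsto_nhds_limUnder ⟨x, hx⟩, tendsto_nhds_limUnder ⟨y, hy⟩⟩
  · rw [RudinShapiro.eta, hx.limUnder_eq, hp, RudinShapiro.isPaired_iff_exists_perm]
  · rwa [RudinShapiro.theta, hy.limUnder_eq]
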